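/- Let $\Xi$ be a set (of trajectories), let $b>0$ be a real number (the rationality coefficient), and let $q\ge 2$ and $M$ be natural numbers with $|\Xi|\ge q$ ($\Xi$ may be infinite). A parameter $(R,\alpha)$ of a mixture of $M$ Plackett–Luce models over $\Xi$ consists of reward functions $R_1,\dots,R_M:\Xi\to\mathbb R$ and mixing coefficients $\alpha_1,\dots,\alpha_M\ge 0$ with $\sum_{m}\alpha_m=1$. For a query $Q\subseteq\Xi$ with $|Q|=q$ it assigns to each ranking $(\xi_1,\dots,\xi_q)$ of the elements of $Q$ (best first) the probability $$P_{R,\alpha}(\xi_1,\dots,\xi_q\mid Q)=\sum_{m=1}^{M}\alpha_m\prod_{j=1}^{q}\frac{\exp(b\,R_m(\xi_j))}{\sum_{j'=j}^{q}\exp(b\,R_m(\xi_{j'}))}.$$ Call a parameter $(R,\alpha)$ identifiable from rankings of size $q$ if, for every parameter $(R',\alpha')$ of a mixture of $M$ models with $P_{R',\alpha'}(\cdot\mid Q)=P_{R,\alpha}(\cdot\mid Q)$ for all $Q\subseteq\Xi$ with $|Q|=q$, there is a permutation $\pi$ of $\{1,\dots,M\}$ such that, for every $m$, $\alpha'_{\pi(m)}=\alpha_m$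 and $R'_{\pi(m)}-R_m$ is constant on $\Xi$. If $$M\le\left\lfloor\frac{q-2}{2}\right\rfloor!\,,$$ then the mixture of $M$ Plackett–Luce models over $\Xi$ is generically identifiable from rankings of size $q$: there is a finite set $F\subseteq\Xi$ such that the points $\big((R_m(\xi))_{1\le m\le M,\ \xi\in F},(\alpha_m)_{1\le m\le M-1}\big)$, taken over all non-identifiable parameters $(R,\alpha)$, form a Lebesgue null set. For finite $\Xi$ this says exactly that the non-identifiable parameters form a Lebesgue null set in the parameter space $\mathbb R^{M\times\Xi}\times\Delta^{M-1}$, where $\Delta^{M-1}$ is the simplex of mixing coefficients. In particular this holds for every $|\Xi|\ge q$, and not only for $|\Xi|=q$. -/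

import Mathlib

open MeasureTheory

noncomputable section

/-- Parameters of a mixture of `M` Plackett–Luce models over a set `T` of trajectories: the `i`-th
mode has the reward function `reward i : T → ℝ` and the mixing coefficient `mix i`; the mixing
coefficients form a probability vector. -/
structure PLMixture (T : Type*) (M : ℕ) where
  reward : Fin M → T → ℝ
  mix : Fin M → ℝ
  mix_mem : mix ∈ stdSimplex ℝ (Fin M)

/-- A ranking of the query `Q`, which has `q` elements: `σ 0` is the top choice, `σ 1` the second
choice, and so on. -/
abbrev Ranking {T : Type*} (Q : Finset T) (q : ℕ) : Type _ := Fin q ≃ Q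

/-- Plackett–Luce probability of the ranking `σ` of the query `Q` for the reward function `R` and
the rationality coefficient `b`: the `j`-th choice is made by the softmax rule among the items that
have not been chosen before. -/
def plProb {T : Type*} (b : ℝ) (R : T → ℝ) {Q : Finset T} {q : ℕ} (σ : Ranking Q q) : ℝ :=
  ∏ j : Fin q, Real.exp (b * R (σ j)) / ∑ k ∈ Finset.Ici j, Real.exp (b * R (σ k))

namespace PLMixture

variable {T : Type*} {M : ℕ}

/-- Probability of the response `σ` to the query `Q` under the mixture. -/
def prob (b : ℝ) (p : PLMixture T M) {Q : Finset T} {q : ℕ} (σ : Ranking Q q) : ℝ :=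
  ∑ i, p.mix i * plProb b (p.reward i) σ

/-- The two mixtures induce the same distribution over the responses to every query of size `q`. -/
def SameResponses (b : ℝ) (q : ℕ) (p p' : PLMixture T M) : Prop :=
  ∀ Q : Finset T, Q.card = q → ∀ σ : Ranking Q q, p.prob b σ = p'.prob b σ

/-- Up to a relabelling of the modes, the mixing coefficients agree and the reward function of each
mode agrees on the whole of `T` up to an additive constant. -/
def Equivalent (p p' : PLMixture T M) : Prop :=
  ∃ π : Equiv.Perm (Fin M), ∀ i, p'.mix (π i) = p.mix i ∧
    ∃ c : ℝ, ∀ t, p'.reward (π i) t = p.reward i t + c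

/-- The parameter `p` is determined, up to equivalence, by the responses to the queries of
size `q`. -/
def IdentifiableAt (b : ℝ) (q : ℕ) (p : PLMixture T M) : Prop :=
  ∀ p' : PLMixture T M, SameResponses b q p p' → Equivalent p p'

/-- The coordinates of a parameter that belong to a finite set `F` of trajectories: the rewards on
`F`, and the mixing coefficients except the last one, which is determined by the others. -/
def coords (F : Finset T) (p : PLMixture T M) : (Fin M → F → ℝ) × (Fin (M - 1) → ℝ) :=
  (fun i t => p.reward i t, fun j => p.mix (j.castLE (Nat.sub_le M 1)))

/-- A set of parameters is null if its coordinates on some finite set of trajectories form a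
Lebesgue null set. When `T` is finite this means that the set is Lebesgue null in the
full parameter space (see `isNull_iff`); the definition also makes sense for infinite `T`. -/
def IsNull (A : Set (PLMixture T M)) : Prop :=
  ∃ F : Finset T, volume (coords F '' A) = 0

theorem isNull_iff [Fintype T] (A : Set (PLMixture T M)) :
    IsNull A ↔ volume (coords Finset.univ '' A) = 0 := by
  refine ⟨fun ⟨F, hF⟩ => ?_, fun h => ⟨_, h⟩⟩
  let L : ((Fin M → ↥(Finset.univ : Finset T) → ℝ) × (Fin (M - 1) → ℝ)) →ₗ[ℝ]
      ((Fin M → F → ℝ) × (Fin (M - 1) → ℝ)) :=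
    { toFun := fun x => (fun i t => x.1 i ⟨t, Finset.mem_univ _⟩, x.2)
      map_add' := fun _ _ => rfl
      map_smul' := fun _ _ => rfl }
  have hL : Function.Surjective L := by
    classical
    rintro ⟨y, z⟩
    refine ⟨(fun i t => if h : (t : T) ∈ F then y i ⟨t, h⟩ else 0, z), ?_⟩
    refine Prod.ext ?_ rfl
    funext i t
    simp [L]
  have haar (F : Finset T) : Measure.IsAddHaarMeasure
      (volume : Measure ((Fin M → F → ℝ) × (Fin (M - 1) → ℝ))) := by
    have h0 : Measure.IsAddHaarMeasure (volume : Measure (F → ℝ)) := inferInstance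
    have h1 : Measure.IsAddHaarMeasure (volume : Measure (Fin M → F → ℝ)) :=
      Measure.pi.isAddHaarMeasure (fun _ : Fin M => (volume : Measure (F → ℝ)))
    have h2 : Measure.IsAddHaarMeasure (volume : Measure (Fin (M - 1) → ℝ)) := inferInstance
    exact Measure.prod.instIsAddHaarMeasure _ _
  have := haar F
  have := haar Finset.univ
  obtain ⟨c, -, hc⟩ := L.exists_map_addHaar_eq_smul_addHaar volume volume hL
  obtain ⟨s, hs, hsm, hs0⟩ := exists_measurable_superset_of_null hF
  have hLm : Measurable L := L.continuous_of_finiteDimensional.measurable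
  have h0 : volume (L ⁻¹' s) = 0 := by
    rw [← Measure.map_apply hLm hsm, hc]
    simp [hs0]
  refine measure_mono_null ?_ h0
  rintro _ ⟨p, hp, rfl⟩
  exact hs ⟨p, hp, rfl⟩

end PLMixture

/-- The mixture of `M` Plackett–Luce models over `T` is generically identifiable from rankings of
size `q`: all parameters outside a null set are identifiable. -/
def PLGenericallyIdentifiable (T : Type*) (M q : ℕ) (b : ℝ) : Prop :=
  PLMixture.IsNull {p : PLMixture T M | ¬ p.IdentifiableAt b q}

end

/-! The proof reads the observed probabilities as a three-way tensor of rank `M`. Summing over the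
positions of unused items, rankings of size `q` determine the rankings of every smaller set. Within
one Plackett–Luce model, the rankings of disjoint sets of items are independent
(`sum_plList_shuffles`). So for disjoint blocks `l₁`, `l₂` of `k = ⌊(q-2)/2⌋` items each and two
more items `c₁`, `c₂`, the observed joint probabilities are `∑ αₘ aₘ ⊗ bₘ ⊗ cₘ`, with one factor for
each block and one for the pair; the sizes fit because `2k + 2 ≤ q`.

If the `aₘ` are independent, the `bₘ` are independent, the `cₘ` are distinct and no `αₘ` vanishes,
simultaneous diagonalisation (`exists_perm_of_simultaneous_decomposition`) makes the decomposition
unique up to permutation and scaling. With the modes matched, inverting the matrix of one block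
isolates each mode, which gives its weight and all reward differences off that block. Since `c₁`
lies off both blocks, the two blocks together recover the rewards on all of `T`
(`identifiableAt_of_det_ne_zero`).

These conditions are the nonvanishing of finitely many analytic functions of the coordinates on `F =
l₁ ∪ l₂ ∪ {c₁, c₂}`. None of the functions is identically zero. For the two determinants this is
`exists_det_plList_ne_zero`: a block has `k! ≥ M` rankings, and models with very large rewards
concentrate on `M` prescribed ones, so that the matrix approaches the identity. Hence the
exceptional set is null. -/

/-! ### Zero sets of analytic functions. -/

/-- The zero set of a real analytic function on a finite-dimensional space that does not vanish
identically is a null set. -/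
theorem AnalyticOnNhd.addHaar_zeros_eq_zero {E : Type*} [NormedAddCommGroup E] [NormedSpace ℝ E]
    [FiniteDimensional ℝ E] [MeasurableSpace E] [BorelSpace E] (μ : Measure E)
    [μ.IsAddHaarMeasure] {f : E → ℝ} (hf : AnalyticOnNhd ℝ f Set.univ) {x₀ : E}
    (hx₀ : f x₀ ≠ 0) : μ {x | f x = 0} = 0 := by
  have hfc : Continuous f := by
    rw [← continuousOn_univ]; exact hf.continuousOn
  have hmeas : MeasurableSet {y : E | f (x₀ + y) = 0} :=
    (isClosed_eq (hfc.comp (continuous_const_add x₀)) continuous_const).measurableSet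
  -- On each line through `x₀` the restriction is analytic in one variable and nonzero at `r = 0`,
  -- so its zeros are discrete.
  have hline (u : E) : volume {r : ℝ | f (x₀ + r • u) = 0} = 0 := by
    have hg : AnalyticOnNhd ℝ (fun r : ℝ => f (x₀ + r • u)) Set.univ := fun r _ =>
      (hf (x₀ + r • u) trivial).comp_of_eq (by fun_prop) rfl
    have h := hg.preimage_zero_mem_codiscrete (x := 0) (by simpa using hx₀)
    have h' := ae_restrict_le_codiscreteWithin (μ := volume) MeasurableSet.univ h
    rw [Measure.restrict_univ, mem_ae_iff] at h'
    convert h' using 2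
    ext r
    simp
  have htrans : μ {x | f x = 0} = μ {y | f (x₀ + y) = 0} :=
    (measure_preimage_add μ x₀ {x | f x = 0}).symm
  rw [htrans]
  -- Polar coordinates around `x₀`: Fubini reduces the claim to rays, where the radial measure has a
  -- density with respect to Lebesgue measure.
  let W : Set (Metric.sphere (0 : E) 1 × Set.Ioi (0 : ℝ)) :=
    {p | f (x₀ + p.2.1 • p.1.1) = 0}
  have hW : MeasurableSet W :=
    (isClosed_eq (by fun_prop) continuous_const).measurableSet
  have hW0 : (μ.toSphere.prod (Measure.volumeIoiPow (Module.finrank ℝ E - 1))) W = 0 := by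
    rw [Measure.measure_prod_null hW]
    refine Filter.Eventually.of_forall fun u => ?_
    refine withDensity_absolutelyContinuous _ _ ?_
    rw [comap_subtype_coe_apply measurableSet_Ioi]
    refine measure_mono_null ?_ (hline u.1)
    rintro _ ⟨r, hr, rfl⟩
    exact hr
  have hpre := (μ.measurePreserving_homeomorphUnitSphereProd).measure_preimage
    hW.nullMeasurableSet
  rw [hW0, comap_subtype_coe_apply (measurableSet_singleton _).compl] at hpre
  refine measure_mono_null ?_ hpre
  intro y hy
  have hy0 : y ≠ 0 := by
    rintro rfl
    exact hx₀ (by simpa using hy)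
  refine ⟨⟨y, hy0⟩, ?_, rfl⟩
  have := norm_ne_zero_iff.2 hy0
  simp only [Set.mem_preimage, W, Set.mem_ofPred_eq, homeomorphUnitSphereProd_apply_fst_coe,
    homeomorphUnitSphereProd_apply_snd_coe, smul_smul]
  simpa [this] using hy

/-! ### Uniqueness of simultaneous diagonalisation. -/

open Matrix in
/-- Uniqueness of a simultaneous diagonalisation: if two bilinear forms `∑ αₘ aₘ ⊗ bₘ` and
`∑ αₘ cₘ aₘ ⊗ bₘ` with independent `aₘ`, independent `bₘ`, nonzero `αₘ` and distinct `cₘ` have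
second decompositions of the same kind, then these agree up to a permutation and rescaling. -/
theorem exists_perm_of_simultaneous_decomposition {n : Type*} [Fintype n] [DecidableEq n]
    {A B A' B' : Matrix n n ℝ} {α α' c c' : n → ℝ} (hA : IsUnit A.det) (hB : IsUnit B.det)
    (hα : ∀ i, α i ≠ 0) (hc : Function.Injective c)
    (h₁ : Aᵀ * diagonal α * B = A'ᵀ * diagonal α' * B')
    (h₂ : Aᵀ * diagonal (fun i => α i * c i) * B = A'ᵀ * diagonal (fun i => α' i * c' i) * B') :
    ∃ (π : Equiv.Perm n) (β γ : n → ℝ), (∀ i, B' (π i) = β i • B i) ∧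
      (∀ i, A' (π i) = γ i • A i) ∧ ∀ i, α i = γ i * α' (π i) * β i := by
  set P : Matrix n n ℝ := A' * A⁻¹ with hP
  set Q : Matrix n n ℝ := B' * B⁻¹ with hQ
  have hPA : A' = P * A := by rw [hP, Matrix.mul_assoc, nonsing_inv_mul A hA, Matrix.mul_one]
  have hQB : B' = Q * B := by rw [hQ, Matrix.mul_assoc, nonsing_inv_mul B hB, Matrix.mul_one]
  have hAt : IsUnit Aᵀ := by rwa [isUnit_iff_isUnit_det, det_transpose]
  have hB' : IsUnit B := by rwa [isUnit_iff_isUnit_det]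
  have cancel {X Y : Matrix n n ℝ} (h : Aᵀ * X * B = A'ᵀ * Y * B') : X = Pᵀ * Y * Q := by
    rw [hPA, hQB, transpose_mul] at h
    refine hAt.mul_left_cancel (hB'.mul_right_cancel ?_)
    rw [h]
    simp only [Matrix.mul_assoc]
  have e₁ : diagonal α = Pᵀ * diagonal α' * Q := cancel h₁
  have e₂ : diagonal (fun i => α i * c i) = Pᵀ * diagonal (fun i => α' i * c' i) * Q := cancel h₂
  have hdet : det (diagonal α) ≠ 0 := by
    rw [det_diagonal]; exact Finset.prod_ne_zero_iff.2 fun i _ => hα i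
  have hdet' : Pᵀ.det * (diagonal α').det * Q.det ≠ 0 := by
    rw [← det_mul, ← det_mul, ← e₁]; exact hdet
  have hQdet : Q.det ≠ 0 := right_ne_zero_of_mul hdet'
  have hPD : IsUnit (Pᵀ * diagonal α') := by
    rw [isUnit_iff_isUnit_det, det_mul]; exact (left_ne_zero_of_mul hdet').isUnit
  -- Dividing the second identity by the first leaves an intertwining relation: `Q i j` can be
  -- nonzero only where `c' i = c j`. As `c` is injective, `Q` is then a permutation matrix up to
  -- scaling.
  have hcomm : Q * diagonal c = diagonal c' * Q := by
    refine hPD.mul_left_cancel ?_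
    have d₁ : diagonal (fun i => α i * c i) = diagonal α * diagonal c := by
      rw [diagonal_mul_diagonal]
    have d₂ : diagonal (fun i => α' i * c' i) = diagonal α' * diagonal c' := by
      rw [diagonal_mul_diagonal]
    rw [← Matrix.mul_assoc, ← e₁, ← d₁, e₂, d₂]
    simp only [Matrix.mul_assoc]
  have hentry (i j : n) : Q i j * c j = c' i * Q i j := by
    have := congrFun (congrFun hcomm i) j
    simpa only [mul_diagonal, diagonal_mul] using this
  have hex (j : n) : ∃ i, Q i j ≠ 0 := by
    by_contra! h
    exact hQdet (det_eq_zero_of_column_eq_zero j h)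
  choose π hπ using hex
  have hcπ {i j : n} (h : Q i j ≠ 0) : c' i = c j := by
    have := hentry i j
    rw [mul_comm] at this
    exact (mul_right_cancel₀ h this).symm
  have hinj : Function.Injective π := fun i j hij => by
    refine hc ?_
    rw [← hcπ (hπ i), ← hcπ (hπ j), hij]
  let σ : Equiv.Perm n := Equiv.ofBijective π (Finite.injective_iff_bijective.1 hinj)
  have hσ (j : n) : σ j = π j := rfl
  have hzero (i j : n) (hij : i ≠ j) : Q (π i) j = 0 := by
    by_contra h
    exact hij (hc ((hcπ (hπ i)).symm.trans (hcπ h)))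
  -- With only one nonzero entry in each column of `Q`, the first identity forces the same pattern
  -- on `P`.
  have hD (i j : n) : diagonal α i j = P (π j) i * α' (π j) * Q (π j) j := by
    rw [e₁, mul_apply, Finset.sum_eq_single (π j)]
    · rw [mul_diagonal, transpose_apply]
    · intro k _ hk
      obtain ⟨k', rfl⟩ := σ.surjective k
      rw [hσ, hzero k' j (fun h => hk (by rw [h, hσ])), mul_zero]
    · simp
  have hα' (j : n) : α' (π j) ≠ 0 := by
    intro h
    have := hD j j
    rw [h, diagonal_apply_eq] at this
    exact hα j (by simpa using this)
  have hzero' (i j : n) (hij : i ≠ j) : P (π j) i = 0 := by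
    have := hD i j
    rw [diagonal_apply_ne _ hij] at this
    simpa [hα' j, hπ j] using this.symm
  refine ⟨σ, fun i => Q (π i) i, fun i => P (π i) i, fun i => ?_, fun i => ?_, fun i => ?_⟩
  · funext k
    rw [hQB, mul_apply, Finset.sum_eq_single i]
    · rfl
    · intro j _ hj
      rw [hσ, hzero i j hj.symm, zero_mul]
    · simp
  · funext k
    rw [hPA, mul_apply, Finset.sum_eq_single i]
    · rfl
    · intro j _ hj
      rw [hσ, hzero' j i hj, zero_mul]
    · simp
  · simpa only [diagonal_apply_eq, hσ] using hD i i

/-! ### Plackett–Luce probabilities of lists and independence of disjoint rankings. -/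

/-- Plackett–Luce probability of the ranking `l` of its own entries, for the weights `w`. -/
noncomputable def plList {T : Type*} (w : T → ℝ) : List T → ℝ
  | [] => 1
  | x :: l => w x / (w x + (l.map w).sum) * plList w l

/-- All interleavings of two lists. -/
def shuffles {T : Type*} : List T → List T → List (List T)
  | [], l => [l]
  | a :: l, [] => [a :: l]
  | a :: l₁, b :: l₂ =>
    (shuffles l₁ (b :: l₂)).map (a :: ·) ++ (shuffles (a :: l₁) l₂).map (b :: ·)
termination_by l₁ l₂ => l₁.length + l₂.length

section PlackettLuceLists

variable {T : Type*} {w : T → ℝ}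

theorem perm_of_mem_shuffles (l₁ l₂ : List T) : ∀ l ∈ shuffles l₁ l₂, l.Perm (l₁ ++ l₂) := by
  fun_induction shuffles l₁ l₂ with
  | case1 l => simp
  | case2 a l => simp
  | case3 a l₁ b l₂ ih₁ ih₂ =>
    intro l hl
    simp only [List.mem_append, List.mem_map] at hl
    obtain ⟨l', h, rfl⟩ | ⟨l', h, rfl⟩ := hl
    · exact (ih₁ l' h).cons a
    · exact ((ih₂ l' h).cons b).trans (List.perm_middle (l₁ := a :: l₁)).symm

theorem List.Perm.sum_map_weight {l l' : List T} (h : l.Perm l') :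
    (l.map w).sum = (l'.map w).sum :=
  (h.map w).sum_eq

theorem sum_map_weight_nonneg (hw : ∀ t, 0 < w t) (l : List T) : 0 ≤ (l.map w).sum := by
  refine List.sum_nonneg fun x hx => ?_
  obtain ⟨t, -, rfl⟩ := List.mem_map.1 hx
  exact (hw t).le

theorem sum_map_cons_mul_plList {a : T} {s : ℝ} (L : List (List T))
    (h : ∀ l ∈ L, w a + (l.map w).sum = s) :
    ((L.map (a :: ·)).map (plList w)).sum = w a / s * (L.map (plList w)).sum := by
  induction L with
  | nil => simp
  | cons l L ih =>
    have h1 := h l (by simp)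
    have h2 := ih fun l' hl' => h l' (by simp [hl'])
    simp only [List.map_cons, List.sum_cons, h2, plList, h1]
    ring

/-- Under the Plackett–Luce model, the relative rankings of two disjoint sets of items are
independent. -/
theorem sum_plList_shuffles (hw : ∀ t, 0 < w t) (l₁ l₂ : List T) :
    ((shuffles l₁ l₂).map (plList w)).sum = plList w l₁ * plList w l₂ := by
  fun_induction shuffles l₁ l₂ with
  | case1 l => simp [plList]
  | case2 a l => simp [plList]
  | case3 a l₁ b l₂ ih₁ ih₂ =>
    have e₁ : ∀ l ∈ shuffles l₁ (b :: l₂), w a + (l.map w).sum =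
        (w a + (l₁.map w).sum) + (w b + (l₂.map w).sum) := fun l hl => by
      rw [(perm_of_mem_shuffles _ _ l hl).sum_map_weight]
      simp only [List.map_append, List.sum_append, List.map_cons, List.sum_cons]
      ring
    have e₂ : ∀ l ∈ shuffles (a :: l₁) l₂, w b + (l.map w).sum =
        (w a + (l₁.map w).sum) + (w b + (l₂.map w).sum) := fun l hl => by
      rw [(perm_of_mem_shuffles _ _ l hl).sum_map_weight]
      simp only [List.map_append, List.sum_append, List.map_cons, List.sum_cons]
      ring
    have p₁ : 0 < w a + (l₁.map w).sum := add_pos_of_pos_of_nonneg (hw a)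
      (sum_map_weight_nonneg hw l₁)
    have p₂ : 0 < w b + (l₂.map w).sum := add_pos_of_pos_of_nonneg (hw b)
      (sum_map_weight_nonneg hw l₂)
    -- Condition on the top item, `a` or `b`. With total weights `S₁`, `S₂` of the two lists, the
    -- identity comes down to `(1/S₁ + 1/S₂)/(S₁ + S₂) = 1/(S₁ S₂)`.
    rw [List.map_append, List.sum_append, sum_map_cons_mul_plList _ e₁,
      sum_map_cons_mul_plList _ e₂, ih₁, ih₂]
    simp only [plList]
    field_simp

theorem plList_singleton (hw : ∀ t, 0 < w t) (t : T) : plList w [t] = 1 := by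
  simp [plList, (hw t).ne']

theorem plList_nonneg (hw : ∀ t, 0 < w t) (l : List T) : 0 ≤ plList w l := by
  induction l with
  | nil => simp [plList]
  | cons x l ih =>
    have := sum_map_weight_nonneg hw l
    have := hw x
    unfold plList
    positivity

theorem plList_le_one (hw : ∀ t, 0 < w t) (l : List T) : plList w l ≤ 1 := by
  induction l with
  | nil => simp [plList]
  | cons x l ih =>
    have h := sum_map_weight_nonneg hw l
    have hx := hw x
    unfold plList
    refine mul_le_one₀ ?_ (plList_nonneg hw l) ih
    rw [div_le_one (by positivity)]
    linarith

theorem plList_ofFn {n : ℕ} (f : Fin n → T) :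
    plList w (List.ofFn f) = ∏ j, w (f j) / ∑ k ∈ Finset.Ici j, w (f k) := by
  induction n with
  | zero => simp [plList]
  | succ n ih =>
    have h0 : Finset.Ici (0 : Fin (n + 1)) = Finset.univ := by ext; simp
    rw [Fin.prod_univ_succ, List.ofFn_succ, plList, ih, h0, Fin.sum_univ_succ, List.map_ofFn,
      List.sum_ofFn]
    simp only [← Fin.map_succEmb_Ici, Finset.sum_map, Fin.coe_succEmb, Function.comp]

/-- The weights of the items for the reward function `R`. -/
noncomputable def plWeight (b : ℝ) (R : T → ℝ) (t : T) : ℝ := Real.exp (b * R t)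

theorem plWeight_pos (b : ℝ) (R : T → ℝ) (t : T) : 0 < plWeight b R t := Real.exp_pos _

theorem plProb_eq_plList (b : ℝ) (R : T → ℝ) {Q : Finset T} {q : ℕ} (σ : Ranking Q q) :
    plProb b R σ = plList (plWeight b R) (List.ofFn fun j => (σ j : T)) := by
  rw [plList_ofFn]
  rfl

/-- A Plackett–Luce model determines the differences of the rewards. -/
theorem sub_eq_sub_of_plList_pair_eq {b : ℝ} (hb : 0 < b) {R R' : T → ℝ} {t s : T}
    (h : plList (plWeight b R) [t, s] = plList (plWeight b R') [t, s]) :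
    R t - R s = R' t - R' s := by
  simp only [plList, List.map_cons, List.map_nil, List.sum_cons, List.sum_nil, add_zero,
    mul_one] at h
  rw [div_self (plWeight_pos b R s).ne', div_self (plWeight_pos b R' s).ne', mul_one, mul_one,
    div_eq_div_iff (add_pos (plWeight_pos b R t) (plWeight_pos b R s)).ne'
      (add_pos (plWeight_pos b R' t) (plWeight_pos b R' s)).ne'] at h
  have h' : plWeight b R t * plWeight b R' s = plWeight b R' t * plWeight b R s := by linarith
  simp only [plWeight, ← Real.exp_add, Real.exp_eq_exp] at h'
  have : b * (R t - R s) = b * (R' t - R' s) := by linarith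
  exact mul_left_cancel₀ hb.ne' this

end PlackettLuceLists

/-! ### Marginals determined by the responses of size `q`. -/

namespace PLMixture

variable {T : Type*} {M : ℕ}

theorem sum_map_sum_mul {ι : Type*} (a : Fin M → ℝ) (f : Fin M → ι → ℝ) (L : List ι) :
    (L.map fun l => ∑ i, a i * f i l).sum = ∑ i, a i * (L.map (f i)).sum := by
  induction L with
  | nil => simp
  | cons l L ih => simp [ih, mul_add, Finset.sum_add_distrib]

/-- Probability that the mixture ranks the entries of the list `l` in the order of `l`. -/
noncomputable def listProb (b : ℝ) (p : PLMixture T M) (l : List T) : ℝ :=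
  ∑ i, p.mix i * plList (plWeight b (p.reward i)) l

theorem sum_listProb_shuffles (b : ℝ) (p : PLMixture T M) (l₁ l₂ : List T) :
    ((shuffles l₁ l₂).map (p.listProb b)).sum = ∑ i, p.mix i *
      (plList (plWeight b (p.reward i)) l₁ * plList (plWeight b (p.reward i)) l₂) := by
  unfold listProb
  rw [sum_map_sum_mul]
  simp only [sum_plList_shuffles (plWeight_pos b _)]

theorem SameResponses.listProb_eq_of_length_eq {b : ℝ} {q : ℕ} {p p' : PLMixture T M}
    (h : SameResponses b q p p') {l : List T} (hl : l.Nodup) (hq : l.length = q) :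
    p.listProb b l = p'.listProb b l := by
  classical
  subst hq
  let σ : Ranking l.toFinset l.length := (hl.getEquiv l).trans
    (Equiv.subtypeEquivRight fun x => by simp)
  have hσ : (List.ofFn fun j => (σ j : T)) = l := by
    have : (fun j => (σ j : T)) = l.get := by
      funext j
      simp [σ]
    rw [this, List.ofFn_get]
  have := h l.toFinset (List.toFinset_card_of_nodup hl) σ
  simpa only [prob, plProb_eq_plList, hσ, listProb] using this

/-- Mixtures with the same responses to queries of size `q` have the same responses to smaller
queries. -/
theorem SameResponses.listProb_eq {b : ℝ} {q : ℕ} (hT : (q : ℕ∞) ≤ ENat.card T)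
    {p p' : PLMixture T M} (h : SameResponses b q p p') {l : List T} (hl : l.Nodup)
    (hq : l.length ≤ q) : p.listProb b l = p'.listProb b l := by
  classical
  obtain ⟨d, hd⟩ := Nat.exists_eq_add_of_le hq
  induction d generalizing l with
  | zero => exact h.listProb_eq_of_length_eq hl (by omega)
  | succ d ih =>
    obtain ⟨x, hx⟩ : ∃ x, x ∉ l := by
      by_contra! hall
      have : Finite T := Set.finite_univ_iff.1 ((List.finite_toSet l).subset fun x _ => hall x)
      have := Fintype.ofFinite T
      rw [ENat.card_eq_coe_fintype_card] at hT
      have h1 : q ≤ Fintype.card T := by exact_mod_cast hT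
      have h2 : l.toFinset = Finset.univ := by ext; simp [hall]
      have h3 := List.toFinset_card_of_nodup hl
      rw [h2, Finset.card_univ] at h3
      omega
    -- Marginalisation: summing over all positions of an extra item `x` recovers the probability of
    -- `l`, since a one-item ranking has probability 1.
    have key : ∀ p : PLMixture T M,
        p.listProb b l = ((shuffles [x] l).map (p.listProb b)).sum := fun p => by
      rw [sum_listProb_shuffles]
      simp only [plList_singleton (plWeight_pos b _), one_mul, listProb]
    rw [key, key]
    congr 1
    refine List.map_congr_left fun l' hl' => ?_
    have hperm := perm_of_mem_shuffles _ _ l' hl'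
    have hlen : l'.length = l.length + 1 := by simpa [add_comm] using hperm.length_eq
    exact ih (hperm.nodup_iff.2 (List.nodup_cons.2 ⟨hx, hl⟩)) (by omega) (by omega)

/-- By independence each side is a sum of ranking probabilities over the interleavings of `l₁` and
`l₂`, and each of these is observable. -/
theorem SameResponses.sum_mul_mul_eq {b : ℝ} {q : ℕ} (hT : (q : ℕ∞) ≤ ENat.card T)
    {p p' : PLMixture T M} (h : SameResponses b q p p') {l₁ l₂ : List T}
    (hl : (l₁ ++ l₂).Nodup) (hq : (l₁ ++ l₂).length ≤ q) :
    ∑ i, p.mix i * (plList (plWeight b (p.reward i)) l₁ * plList (plWeight b (p.reward i)) l₂) =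
    ∑ i, p'.mix i *
      (plList (plWeight b (p'.reward i)) l₁ * plList (plWeight b (p'.reward i)) l₂) := by
  rw [← sum_listProb_shuffles, ← sum_listProb_shuffles]
  congr 1
  refine List.map_congr_left fun l' hl' => ?_
  have hperm := perm_of_mem_shuffles _ _ l' hl'
  exact h.listProb_eq hT (hperm.nodup_iff.2 hl) (hperm.length_eq ▸ hq)

/-- Interleaving `l₁` with `l₂` reduces three factors to two. -/
theorem SameResponses.sum_mul_mul_mul_eq {b : ℝ} {q : ℕ} (hT : (q : ℕ∞) ≤ ENat.card T)
    {p p' : PLMixture T M} (h : SameResponses b q p p') {l₁ l₂ l₃ : List T}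
    (hl : (l₁ ++ l₂ ++ l₃).Nodup) (hq : (l₁ ++ l₂ ++ l₃).length ≤ q) :
    ∑ i, p.mix i * (plList (plWeight b (p.reward i)) l₁ *
      plList (plWeight b (p.reward i)) l₂ * plList (plWeight b (p.reward i)) l₃) =
    ∑ i, p'.mix i * (plList (plWeight b (p'.reward i)) l₁ *
      plList (plWeight b (p'.reward i)) l₂ * plList (plWeight b (p'.reward i)) l₃) := by
  have key : ∀ p : PLMixture T M, ∑ i, p.mix i * (plList (plWeight b (p.reward i)) l₁ *
      plList (plWeight b (p.reward i)) l₂ * plList (plWeight b (p.reward i)) l₃) =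
      ((shuffles l₁ l₂).map fun l => ∑ i, p.mix i *
        (plList (plWeight b (p.reward i)) l * plList (plWeight b (p.reward i)) l₃)).sum := by
    intro p
    rw [sum_map_sum_mul]
    simp only [List.sum_map_mul_right, sum_plList_shuffles (plWeight_pos b _)]
  rw [key, key]
  congr 1
  refine List.map_congr_left fun l' hl' => ?_
  have hperm := (perm_of_mem_shuffles _ _ l' hl').append_right l₃
  exact h.sum_mul_mul_eq hT (hperm.nodup_iff.2 hl) (hperm.length_eq ▸ hq)

end PLMixture

/-! ### Concentration of scaled models, and analyticity in the rewards. -/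

section GenericIndependence

open Filter Topology

variable {T : Type*}

/-- As the scale `s` grows, each choice picks the best remaining item with probability tending to 1.
-/
theorem tendsto_plList_one {b : ℝ} (hb : 0 < b) {r : T → ℝ} {l : List T}
    (hl : l.Pairwise fun x y => r y < r x) :
    Tendsto (fun s : ℝ => plList (plWeight b fun t => s * r t) l) atTop (𝓝 1) := by
  induction l with
  | nil => simp [plList]
  | cons x l ih =>
    rw [List.pairwise_cons] at hl
    have hsum : Tendsto (fun s : ℝ => (l.map fun y => Real.exp (s * (b * (r y - r x)))).sum)
        atTop (𝓝 0) := by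
      have h := hl.1
      clear ih hl
      induction l with
      | nil => simp
      | cons y l ih =>
        have hy : b * (r y - r x) < 0 := mul_neg_of_pos_of_neg hb (sub_neg.2 (h y (by simp)))
        have h₁ : Tendsto (fun s : ℝ => Real.exp (s * (b * (r y - r x)))) atTop (𝓝 0) :=
          Real.tendsto_exp_atBot.comp (tendsto_id.atTop_mul_const_of_neg hy)
        simpa using h₁.add (ih fun z hz => h z (by simp [hz]))
    have hfac : Tendsto (fun s : ℝ => (plWeight b fun t => s * r t) x /
        ((plWeight b fun t => s * r t) x + (l.map (plWeight b fun t => s * r t)).sum))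
        atTop (𝓝 1) := by
      have h : Tendsto (fun s : ℝ => (1 + (l.map fun y => Real.exp (s * (b * (r y - r x)))).sum)⁻¹)
          atTop (𝓝 (1 + 0)⁻¹) := (hsum.const_add 1).inv₀ (by norm_num)
      rw [add_zero, inv_one] at h
      refine h.congr fun s => ?_
      have hx := plWeight_pos b (fun t => s * r t) x
      have hs : (l.map (plWeight b fun t => s * r t)).sum = (plWeight b fun t => s * r t) x *
          (l.map fun y => Real.exp (s * (b * (r y - r x)))).sum := by
        rw [← List.sum_map_mul_left]
        congr 1
        refine List.map_congr_left fun y _ => ?_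
        rw [plWeight, plWeight, ← Real.exp_add]
        congr 1
        ring
      rw [hs, ← mul_one_add, div_mul_eq_div_div, div_self hx.ne', one_div]
    simpa [plList] using hfac.mul (ih hl.2)

/-- At the last position from which the list is not sorted, some later item beats the chosen one,
and that factor decays exponentially; all other factors are at most 1. -/
theorem tendsto_plList_zero {b : ℝ} (hb : 0 < b) {r : T → ℝ} {l : List T}
    (hne : l.Pairwise fun x y => r x ≠ r y) (hl : ¬ l.Pairwise fun x y => r y < r x) :
    Tendsto (fun s : ℝ => plList (plWeight b fun t => s * r t) l) atTop (𝓝 0) := by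
  induction l with
  | nil => simp at hl
  | cons x l ih =>
    rw [List.pairwise_cons] at hne hl
    have hw (s : ℝ) := plWeight_pos b fun t => s * r t
    have hfac (s : ℝ) (y : T) (hy : y ∈ x :: l) : (plWeight b fun t => s * r t) x /
        ((plWeight b fun t => s * r t) x + (l.map (plWeight b fun t => s * r t)).sum) ≤
        (plWeight b fun t => s * r t) x / (plWeight b fun t => s * r t) y := by
      refine div_le_div_of_nonneg_left (hw s x).le (hw s y) ?_
      rw [← List.sum_cons, ← List.map_cons]
      refine List.single_le_sum ?_ _ (List.mem_map_of_mem hy)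
      intro z hz
      obtain ⟨t, -, rfl⟩ := List.mem_map.1 hz
      exact (hw s t).le
    by_cases h : l.Pairwise fun x y => r y < r x
    · obtain ⟨y, hy, hxy⟩ : ∃ y ∈ l, r x < r y := by
        by_contra! hall
        exact hl ⟨fun y hy => lt_of_le_of_ne (hall y hy) (hne.1 y hy).symm, h⟩
      have hneg : b * (r x - r y) < 0 := mul_neg_of_pos_of_neg hb (sub_neg.2 hxy)
      have hlim : Tendsto (fun s : ℝ => Real.exp (s * (b * (r x - r y)))) atTop (𝓝 0) :=
        Real.tendsto_exp_atBot.comp (tendsto_id.atTop_mul_const_of_neg hneg)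
      refine squeeze_zero (fun s => plList_nonneg (hw s) _) (fun s => ?_) hlim
      refine (mul_le_of_le_one_right ?_ (plList_le_one (hw s) l)).trans
        ((hfac s y (by simp [hy])).trans_eq ?_)
      · have := sum_map_weight_nonneg (hw s) l
        have := hw s x
        positivity
      · rw [plWeight, plWeight, ← Real.exp_sub]
        congr 1
        ring
    · refine squeeze_zero (fun s => plList_nonneg (hw s) _) (fun s => ?_) (ih hne.2 h)
      refine mul_le_of_le_one_left (plList_nonneg (hw s) l) ?_
      exact (hfac s x (by simp)).trans_eq (div_self (hw s x).ne')

theorem pairwise_idxOf_lt [DecidableEq T] {l : List T} (hl : l.Nodup) :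
    l.Pairwise fun x y => l.idxOf x < l.idxOf y := by
  rw [List.pairwise_iff_getElem]
  intro i j hi hj hij
  rwa [hl.idxOf_getElem, hl.idxOf_getElem]

/-- Distinct rankings of the same items are separated by suitable Plackett–Luce models. -/
theorem exists_det_plList_ne_zero {n : Type*} [Fintype n] [DecidableEq n] {b : ℝ} (hb : 0 < b)
    {l₀ : List T} (hl₀ : l₀.Nodup) {L : n → List T} (hL : Function.Injective L)
    (hperm : ∀ i, (L i).Perm l₀) :
    ∃ R : n → T → ℝ, (Matrix.of fun i j => plList (plWeight b (R i)) (L j)).det ≠ 0 := by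
  classical
  -- The rewards `r i` decrease along `L i`, so scaling them makes row `i` converge to row `i` of
  -- the identity matrix.
  let r : n → T → ℝ := fun i t => -((L i).idxOf t : ℝ)
  have hnodup (i : n) : (L i).Nodup := (hperm i).nodup_iff.2 hl₀
  have hentry (i j : n) : Tendsto (fun s : ℝ => plList (plWeight b fun t => s * r i t) (L j)) atTop
      (𝓝 ((1 : Matrix n n ℝ) i j)) := by
    have hsorted : (L i).Pairwise fun x y => r i y < r i x :=
      (pairwise_idxOf_lt (hnodup i)).imp fun h => by simpa [r] using h
    by_cases hij : i = j
    · subst hij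
      rw [Matrix.one_apply_eq]
      exact tendsto_plList_one hb hsorted
    · rw [Matrix.one_apply_ne hij]
      have hp : (L j).Perm (L i) := (hperm j).trans (hperm i).symm
      refine tendsto_plList_zero hb ?_ fun h => hij (hL ?_)
      · refine (hnodup j).imp_of_mem fun {x y} hx _ hxy h => hxy ?_
        exact (List.idxOf_inj (hp.mem_iff.1 hx)).1 (by simpa [r] using h)
      · refine (hp.eq_of_pairwise ?_ h hsorted).symm
        intro x y _ _ h₁ h₂
        exact absurd h₁ h₂.not_gt
  have hmat : Tendsto (fun s : ℝ => Matrix.of fun i j =>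
      plList (plWeight b fun t => s * r i t) (L j)) atTop (𝓝 (1 : Matrix n n ℝ)) :=
    tendsto_pi_nhds.2 fun i => tendsto_pi_nhds.2 fun j => hentry i j
  have hdet := ((continuous_id.matrix_det).tendsto (1 : Matrix n n ℝ)).comp hmat
  have hev := hdet.eventually_ne (b₂ := 0) (by simp)
  obtain ⟨s, hs⟩ := hev.exists
  exact ⟨fun i t => s * r i t, hs⟩

theorem plList_congr {w w' : T → ℝ} {l : List T} (h : ∀ t ∈ l, w t = w' t) :
    plList w l = plList w' l := by
  induction l with
  | nil => rfl
  | cons x l ih =>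
    have h' : ∀ t ∈ l, w t = w' t := fun t ht => h t (by simp [ht])
    rw [plList, plList, ih h', h x (by simp), List.map_congr_left h']

variable {E : Type*} [NormedAddCommGroup E] [NormedSpace ℝ E]

theorem analyticOnNhd_plList (b : ℝ) {R : E → T → ℝ}
    (hR : ∀ t, AnalyticOnNhd ℝ (fun x => R x t) Set.univ) (l : List T) :
    AnalyticOnNhd ℝ (fun x => plList (plWeight b (R x)) l) Set.univ := by
  have hw (t : T) : AnalyticOnNhd ℝ (fun x => plWeight b (R x) t) Set.univ :=
    (analyticOnNhd_const.mul (hR t)).rexp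
  have hsum (l : List T) :
      AnalyticOnNhd ℝ (fun x => (l.map (plWeight b (R x))).sum) Set.univ := by
    induction l with
    | nil => simpa using analyticOnNhd_const
    | cons t l ih =>
      simp only [List.map_cons, List.sum_cons]
      exact (hw t).add ih
  induction l with
  | nil => exact analyticOnNhd_const
  | cons t l ih =>
    refine ((hw t).div ((hw t).add (hsum l)) fun x _ => ?_).mul ih
    exact (add_pos_of_pos_of_nonneg (plWeight_pos b _ t)
      (sum_map_weight_nonneg (plWeight_pos b _) l)).ne'

theorem analyticOnNhd_det {n : Type*} [Fintype n] [DecidableEq n] {A : E → Matrix n n ℝ}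
    (hA : ∀ i j, AnalyticOnNhd ℝ (fun x => A x i j) Set.univ) :
    AnalyticOnNhd ℝ (fun x => (A x).det) Set.univ := by
  simp only [Matrix.det_apply']
  refine Finset.analyticOnNhd_fun_sum _ fun σ _ => analyticOnNhd_const.mul ?_
  exact Finset.analyticOnNhd_fun_prod _ fun i _ => hA _ _

end GenericIndependence

/-! ### Recovering the parameters from the matched modes. -/

namespace PLMixture

variable {T : Type*} {M : ℕ}

/-- The joint probabilities of `l` with the rankings `L j` are combinations of the rows of an
invertible matrix. Comparing coefficients separates the modes, for any `l` disjoint from the block.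
-/
theorem SameResponses.mix_mul_plList_eq {b : ℝ} {q : ℕ} (hT : (q : ℕ∞) ≤ ENat.card T)
    {p p' : PLMixture T M} (h : SameResponses b q p p') {L : Fin M → List T}
    (hdet : IsUnit (Matrix.of fun i j => plList (plWeight b (p.reward i)) (L j)).det)
    {π : Equiv.Perm (Fin M)} {β : Fin M → ℝ}
    (hβ : ∀ i j, plList (plWeight b (p'.reward (π i))) (L j) =
      β i * plList (plWeight b (p.reward i)) (L j))
    {l : List T} (hl : ∀ j, (l ++ L j).Nodup) (hq : ∀ j, (l ++ L j).length ≤ q) (i : Fin M) :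
    p.mix i * plList (plWeight b (p.reward i)) l =
      p'.mix (π i) * β i * plList (plWeight b (p'.reward (π i))) l := by
  refine congrFun (Matrix.vecMul_injective_of_isUnit ((Matrix.isUnit_iff_isUnit_det _).2 hdet)
    (a₁ := fun i => p.mix i * plList (plWeight b (p.reward i)) l)
    (a₂ := fun i => p'.mix (π i) * β i * plList (plWeight b (p'.reward (π i))) l) ?_) i
  funext j
  have := h.sum_mul_mul_eq hT (hl j) (hq j)
  rw [← Equiv.sum_comp π fun i => p'.mix i * _] at this
  simp only [hβ] at this
  refine (Finset.sum_congr rfl fun i _ => ?_).trans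
    (this.trans (Finset.sum_congr rfl fun i _ => ?_)) <;>
  · simp only [Matrix.of_apply]
    ring

/-- A mixture is identifiable if its modes have independent ranking distributions on each of two
disjoint sets of items, are separated by a further pair of items, and all have nonzero weight. -/
theorem identifiableAt_of_det_ne_zero {b : ℝ} (hb : 0 < b) {q : ℕ} (hT : (q : ℕ∞) ≤ ENat.card T)
    {p : PLMixture T M} {l₁ l₂ : List T} {c₁ c₂ : T}
    (hnodup : (l₁ ++ l₂ ++ [c₁, c₂]).Nodup) (hlen : (l₁ ++ l₂ ++ [c₁, c₂]).length ≤ q)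
    {L₁ L₂ : Fin M → List T} (hL₁ : ∀ i, (L₁ i).Perm l₁) (hL₂ : ∀ i, (L₂ i).Perm l₂)
    (hdet₁ : (Matrix.of fun i j => plList (plWeight b (p.reward i)) (L₁ j)).det ≠ 0)
    (hdet₂ : (Matrix.of fun i j => plList (plWeight b (p.reward i)) (L₂ j)).det ≠ 0)
    (hmix : ∀ i, p.mix i ≠ 0)
    (hc : Function.Injective fun i => p.reward i c₁ - p.reward i c₂) :
    p.IdentifiableAt b q := by
  intro p' h
  have hperm (i j : Fin M) (l : List T) : (L₁ i ++ L₂ j ++ l).Perm (l₁ ++ l₂ ++ l) :=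
    ((hL₁ i).append (hL₂ j)).append_right l
  have hn₀ : (l₁ ++ l₂).Nodup := (List.nodup_append.1 hnodup).1
  have hlen₀ : l₁.length + l₂.length + 2 ≤ q := by simpa [add_assoc] using hlen
  -- The probability of ranking `c₁` above `c₂` plays the role of the eigenvalue that tells the
  -- modes apart.
  obtain ⟨π, β, γ, hβ, hγ, hmul⟩ := exists_perm_of_simultaneous_decomposition
    (A := Matrix.of fun i j => plList (plWeight b (p.reward i)) (L₁ j))
    (B := Matrix.of fun i j => plList (plWeight b (p.reward i)) (L₂ j))
    (A' := Matrix.of fun i j => plList (plWeight b (p'.reward i)) (L₁ j))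
    (B' := Matrix.of fun i j => plList (plWeight b (p'.reward i)) (L₂ j))
    (α := p.mix) (α' := p'.mix) (c := fun i => plList (plWeight b (p.reward i)) [c₁, c₂])
    (c' := fun i => plList (plWeight b (p'.reward i)) [c₁, c₂])
    hdet₁.isUnit hdet₂.isUnit hmix
    (fun i j hij => hc (sub_eq_sub_of_plList_pair_eq hb hij))
    (by
      ext i j
      rw [Matrix.mul_apply, Matrix.mul_apply]
      simp only [Matrix.mul_diagonal, Matrix.transpose_apply, Matrix.of_apply]
      have hp : (L₁ i ++ L₂ j).Perm (l₁ ++ l₂) := (hL₁ i).append (hL₂ j)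
      have := h.sum_mul_mul_eq hT (hp.nodup_iff.2 hn₀)
        (by rw [hp.length_eq, List.length_append]; omega)
      convert this using 2 <;> ring)
    (by
      ext i j
      rw [Matrix.mul_apply, Matrix.mul_apply]
      simp only [Matrix.mul_diagonal, Matrix.transpose_apply, Matrix.of_apply]
      have hp := hperm i j [c₁, c₂]
      have := h.sum_mul_mul_mul_eq hT (hp.nodup_iff.2 hnodup) (hp.length_eq ▸ hlen)
      convert this using 2 <;> ring)
  have hβ' (i j : Fin M) : plList (plWeight b (p'.reward (π i))) (L₂ j) =
      β i * plList (plWeight b (p.reward i)) (L₂ j) := congrFun (hβ i) j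
  have hγ' (i j : Fin M) : plList (plWeight b (p'.reward (π i))) (L₁ j) =
      γ i * plList (plWeight b (p.reward i)) (L₁ j) := congrFun (hγ i) j
  have hlen₁ (j : Fin M) : (L₁ j).length = l₁.length := (hL₁ j).length_eq
  have hlen₂ (j : Fin M) : (L₂ j).length = l₂.length := (hL₂ j).length_eq
  have hn₁ (j : Fin M) : (L₁ j).Nodup := (hL₁ j).nodup_iff.2 (List.nodup_append.1 hn₀).1
  have hn₂ (j : Fin M) : (L₂ j).Nodup := (hL₂ j).nodup_iff.2 (List.nodup_append.1 hn₀).2.1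
  -- Taking `l = []` gives `α = α' γ`, and likewise `α = α' β`; together with `α = γ α' β` this
  -- forces the scalings to be 1.
  have hmix₁ (i : Fin M) : p.mix i = p'.mix (π i) * γ i := by
    simpa [plList] using h.mix_mul_plList_eq hT hdet₁.isUnit hγ' (l := [])
      (fun j => by simpa using hn₁ j) (fun j => by simp [hlen₁]; omega) i
  have hmix₂ (i : Fin M) : p.mix i = p'.mix (π i) * β i := by
    simpa [plList] using h.mix_mul_plList_eq hT hdet₂.isUnit hβ' (l := [])
      (fun j => by simpa using hn₂ j) (fun j => by simp [hlen₂]; omega) i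
  -- Here `t` and `s` are any items off `l₁`, including items of `l₂` or outside `F`: a block and
  -- two items still fit in a query.
  have hsub₁ (i : Fin M) (t s : T) (ht : t ∉ l₁) (hs : s ∉ l₁) :
      p.reward i t - p.reward i s = p'.reward (π i) t - p'.reward (π i) s := by
    by_cases hts : t = s
    · simp [hts]
    have := h.mix_mul_plList_eq hT hdet₁.isUnit hγ' (l := [t, s])
      (fun j => by simp [hn₁ j, (hL₁ j).mem_iff, ht, hs, hts])
      (fun j => by simp [hlen₁]; omega) i
    rw [← hmix₁] at this
    exact sub_eq_sub_of_plList_pair_eq hb (mul_left_cancel₀ (hmix i) this)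
  have hsub₂ (i : Fin M) (t s : T) (ht : t ∉ l₂) (hs : s ∉ l₂) :
      p.reward i t - p.reward i s = p'.reward (π i) t - p'.reward (π i) s := by
    by_cases hts : t = s
    · simp [hts]
    have := h.mix_mul_plList_eq hT hdet₂.isUnit hβ' (l := [t, s])
      (fun j => by simp [hn₂ j, (hL₂ j).mem_iff, ht, hs, hts])
      (fun j => by simp [hlen₂]; omega) i
    rw [← hmix₂] at this
    exact sub_eq_sub_of_plList_pair_eq hb (mul_left_cancel₀ (hmix i) this)
  have hdisj := List.nodup_append.1 hnodup |>.2.2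
  have hc₁ : c₁ ∉ l₁ := fun hmem => hdisj c₁ (by simp [hmem]) c₁ (by simp) rfl
  have hc₂ : c₁ ∉ l₂ := fun hmem => hdisj c₁ (by simp [hmem]) c₁ (by simp) rfl
  -- `c₁` is the common reference point: any `t` avoids at least one of the two blocks and is
  -- compared with `c₁` through that block.
  refine ⟨π, fun i => ⟨?_, p'.reward (π i) c₁ - p.reward i c₁, fun t => ?_⟩⟩
  · have hβ1 : β i = 1 := by
      have := hmul i
      rw [mul_comm (γ i), ← hmix₁] at this
      exact mul_left_cancel₀ (hmix i) (by rw [mul_one]; exact this.symm)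
    rw [hmix₂ i, hβ1, mul_one]
  · by_cases ht : t ∈ l₁
    · have ht₂ : t ∉ l₂ := fun hmem => (List.nodup_append.1 hn₀).2.2 t ht t hmem rfl
      linarith [hsub₂ i t c₁ ht₂ hc₂]
    · linarith [hsub₁ i t c₁ ht hc₁]

/-! ### Coordinates of the parameter space. -/

/-- The reward function of the `i`-th mode with given coordinates on `F`, extended by zero. -/
noncomputable def rewardOfCoords [DecidableEq T] (F : Finset T)
    (x : (Fin M → F → ℝ) × (Fin (M - 1) → ℝ)) (i : Fin M) (t : T) : ℝ :=
  if h : t ∈ F then x.1 i ⟨t, h⟩ else 0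

theorem rewardOfCoords_coords [DecidableEq T] {F : Finset T} (p : PLMixture T M) (i : Fin M) {t : T}
    (ht : t ∈ F) : rewardOfCoords F (p.coords F) i t = p.reward i t := by
  simp [rewardOfCoords, ht, coords]

theorem analyticOnNhd_rewardOfCoords [DecidableEq T] (F : Finset T) (i : Fin M) (t : T) :
    AnalyticOnNhd ℝ (fun x => rewardOfCoords F x i t) Set.univ := by
  by_cases h : t ∈ F
  · simp only [rewardOfCoords, h, dite_true]
    let φ : ((Fin M → F → ℝ) × (Fin (M - 1) → ℝ)) →L[ℝ] ℝ :=
      (ContinuousLinearMap.proj (R := ℝ) (φ := fun _ : F => ℝ) ⟨t, h⟩).comp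
        ((ContinuousLinearMap.proj (R := ℝ) (φ := fun _ : Fin M => F → ℝ) i).comp
          (ContinuousLinearMap.fst ℝ _ _))
    exact φ.analyticOnNhd _
  · simpa only [rewardOfCoords, h, dite_false] using analyticOnNhd_const

/-- The mixing coefficients with given coordinates. -/
noncomputable def mixOfCoords (y : Fin (M - 1) → ℝ) (i : Fin M) : ℝ :=
  if h : (i : ℕ) < M - 1 then y ⟨i, h⟩ else 1 - ∑ j, y j

theorem mixOfCoords_coords (F : Finset T) (p : PLMixture T M) (i : Fin M) :
    mixOfCoords (p.coords F).2 i = p.mix i := by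
  obtain _ | n := M
  · exact i.elim0
  have hsum := p.mix_mem.2
  rw [Fin.sum_univ_castSucc] at hsum
  unfold mixOfCoords coords
  split_ifs with h
  · rfl
  · have hi : i = Fin.last n := Fin.ext (by have := i.2; simp at h ⊢; omega)
    rw [hi, sub_eq_iff_eq_add, ← hsum, add_comm]
    rfl

theorem analyticOnNhd_mixOfCoords (F : Finset T) (i : Fin M) :
    AnalyticOnNhd ℝ (fun x : (Fin M → F → ℝ) × (Fin (M - 1) → ℝ) => mixOfCoords x.2 i)
      Set.univ := by
  have h (j : Fin (M - 1)) :
      AnalyticOnNhd ℝ (fun x : (Fin M → F → ℝ) × (Fin (M - 1) → ℝ) => x.2 j) Set.univ :=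
    ((ContinuousLinearMap.proj j).comp
      (ContinuousLinearMap.snd ℝ (Fin M → F → ℝ) (Fin (M - 1) → ℝ))).analyticOnNhd _
  by_cases hi : (i : ℕ) < M - 1
  · simpa only [mixOfCoords, hi, dite_true] using h _
  · simp only [mixOfCoords, hi, dite_false]
    exact analyticOnNhd_const.sub (Finset.analyticOnNhd_fun_sum _ fun j _ => h j)

theorem exists_mixOfCoords_ne_zero (i : Fin M) : ∃ y : Fin (M - 1) → ℝ, mixOfCoords y i ≠ 0 := by
  by_cases hi : (i : ℕ) < M - 1
  · exact ⟨fun _ => 1, by simp [mixOfCoords, hi]⟩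
  · exact ⟨fun _ => 0, by simp [mixOfCoords, hi]⟩

theorem isAddHaarMeasure_volume_coords (F : Finset T) : Measure.IsAddHaarMeasure
    (volume : Measure ((Fin M → F → ℝ) × (Fin (M - 1) → ℝ))) := by
  have : Measure.IsAddHaarMeasure (volume : Measure (Fin M → F → ℝ)) :=
    Measure.pi.isAddHaarMeasure (fun _ : Fin M => (volume : Measure (F → ℝ)))
  exact Measure.prod.instIsAddHaarMeasure _ _

end PLMixture

/-! ### Choice of the blocks and the null set. -/

theorem exists_injective_perm {T : Type*} {M : ℕ} {l : List T} (hl : l.Nodup)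
    (hM : M ≤ l.length.factorial) :
    ∃ L : Fin M → List T, Function.Injective L ∧ ∀ i, (L i).Perm l := by
  have hlen : l.permutations.length = l.length.factorial := List.length_permutations l
  refine ⟨fun i => l.permutations[i.1]'(by omega), fun i j hij => Fin.ext ?_, fun i => ?_⟩
  · exact ((List.nodup_permutations l hl).getElem_inj_iff).1 hij
  · exact List.mem_permutations.1 (List.getElem_mem _)

theorem exists_nodup_of_le_card {T : Type*} {q : ℕ} (hT : (q : ℕ∞) ≤ ENat.card T) :
    ∃ l : List T, l.Nodup ∧ l.length = q := by
  rw [← Set.encard_univ] at hT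
  obtain ⟨s, -, hs⟩ := Set.exists_subset_encard_eq hT
  have hfin : s.Finite := Set.finite_of_encard_eq_coe hs
  refine ⟨hfin.toFinset.toList, Finset.nodup_toList _, ?_⟩
  rw [hfin.encard_eq_coe_toFinset_card] at hs
  rw [Finset.length_toList]
  exact_mod_cast hs

theorem mainTheorem6 (T : Type*) (M q : ℕ) (b : ℝ) (hb : 0 < b) (hq : 2 ≤ q)
    (hT : (q : ℕ∞) ≤ ENat.card T) (hM : M ≤ ((q - 2) / 2).factorial) :
    PLGenericallyIdentifiable T M q b := by
  classical
  set k := (q - 2) / 2 with hk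
  obtain ⟨l, hl, hlq⟩ := exists_nodup_of_le_card hT
  obtain ⟨l₁, l₂, c₁, c₂, hnodup, h₁, h₂⟩ : ∃ (l₁ l₂ : List T) (c₁ c₂ : T),
      (l₁ ++ l₂ ++ [c₁, c₂]).Nodup ∧ l₁.length = k ∧ l₂.length = k := by
    -- The list `l` is cut into two blocks of length `k` and the next two entries, which exist since
    -- `2k + 2 ≤ q`.
    obtain ⟨c₁, c₂, h⟩ : ∃ c₁ c₂, (l.drop (k + k)).take 2 = [c₁, c₂] := by
      rw [← List.length_eq_two]
      simp
      omega
    refine ⟨l.take k, (l.drop k).take k, c₁, c₂, ?_, by simp; omega, by simp; omega⟩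
    rw [← h, ← List.take_add, ← List.take_add]
    exact hl.sublist (List.take_sublist _ _)
  have hlen : (l₁ ++ l₂ ++ [c₁, c₂]).length ≤ q := by simp [h₁, h₂]; omega
  have hn₀ : (l₁ ++ l₂).Nodup := (List.nodup_append.1 hnodup).1
  obtain ⟨L₁, hinj₁, hL₁⟩ := exists_injective_perm (List.nodup_append.1 hn₀).1 (h₁ ▸ hM)
  obtain ⟨L₂, hinj₂, hL₂⟩ := exists_injective_perm (List.nodup_append.1 hn₀).2.1 (h₂ ▸ hM)
  let F : Finset T := (l₁ ++ l₂ ++ [c₁, c₂]).toFinset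
  have := PLMixture.isAddHaarMeasure_volume_coords (M := M) F
  have hF₁ (j : Fin M) (t : T) (ht : t ∈ L₁ j) : t ∈ F := by
    simp [F, (hL₁ j).mem_iff.1 ht]
  have hF₂ (j : Fin M) (t : T) (ht : t ∈ L₂ j) : t ∈ F := by
    simp [F, (hL₂ j).mem_iff.1 ht]
  have hFc₁ : c₁ ∈ F := by simp [F]
  have hFc₂ : c₂ ∈ F := by simp [F]
  have hc : c₁ ≠ c₂ := by
    have := (List.nodup_append.1 hnodup).2.1
    simpa using this
  have hdet {l₀ : List T} (hl₀ : l₀.Nodup) {L : Fin M → List T} (hL : Function.Injective L)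
      (hperm : ∀ i, (L i).Perm l₀) (hF : ∀ j, ∀ t ∈ L j, t ∈ F) :
      volume {x | (Matrix.of fun i j => plList (plWeight b
        (PLMixture.rewardOfCoords F x i)) (L j)).det = 0} = 0 := by
    obtain ⟨R, hR⟩ := exists_det_plList_ne_zero hb hl₀ hL hperm
    refine AnalyticOnNhd.addHaar_zeros_eq_zero volume (x₀ := (fun i t => R i t, 0))
      (analyticOnNhd_det fun i j => analyticOnNhd_plList b
        (PLMixture.analyticOnNhd_rewardOfCoords F i) (L j)) ?_
    convert hR using 3
    ext i j
    refine plList_congr fun t ht => ?_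
    simp [plWeight, PLMixture.rewardOfCoords, hF j t ht]
  have hmix (i : Fin M) : volume {x : (Fin M → F → ℝ) × (Fin (M - 1) → ℝ) |
      PLMixture.mixOfCoords x.2 i = 0} = 0 := by
    obtain ⟨y, hy⟩ := PLMixture.exists_mixOfCoords_ne_zero i
    exact AnalyticOnNhd.addHaar_zeros_eq_zero volume (x₀ := (0, y))
      (PLMixture.analyticOnNhd_mixOfCoords F i) hy
  have hpair (i j : Fin M) (hij : i ≠ j) : volume {x : (Fin M → F → ℝ) × (Fin (M - 1) → ℝ) |
      PLMixture.rewardOfCoords F x i c₁ - PLMixture.rewardOfCoords F x i c₂ -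
      (PLMixture.rewardOfCoords F x j c₁ - PLMixture.rewardOfCoords F x j c₂) = 0} = 0 := by
    -- At the point where mode `i` has reward 1 at `c₁` and all other rewards are 0, the function
    -- takes the value 1.
    refine AnalyticOnNhd.addHaar_zeros_eq_zero volume
      (x₀ := (fun i' t => if i' = i ∧ (t : T) = c₁ then 1 else 0, 0)) ?_ ?_
    · have := PLMixture.analyticOnNhd_rewardOfCoords (M := M) F
      exact ((this i c₁).sub (this i c₂)).sub ((this j c₁).sub (this j c₂))
    · simp [PLMixture.rewardOfCoords, hFc₁, hFc₂, hc.symm, hij.symm]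
  -- The exceptional set: a block matrix is singular, a mixing coefficient vanishes, or two modes
  -- have the same reward difference on `c₁`, `c₂`.
  refine ⟨F, measure_mono_null (t := {x | (Matrix.of fun i j => plList (plWeight b
      (PLMixture.rewardOfCoords F x i)) (L₁ j)).det = 0} ∪ {x | (Matrix.of fun i j => plList
      (plWeight b (PLMixture.rewardOfCoords F x i)) (L₂ j)).det = 0} ∪
      (⋃ i, {x | PLMixture.mixOfCoords x.2 i = 0}) ∪
      ⋃ i, ⋃ j, ⋃ (_ : i ≠ j), {x | PLMixture.rewardOfCoords F x i c₁ -
        PLMixture.rewardOfCoords F x i c₂ - (PLMixture.rewardOfCoords F x j c₁ -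
        PLMixture.rewardOfCoords F x j c₂) = 0}) ?_ ?_⟩
  · rintro _ ⟨p, hp, rfl⟩
    by_contra hx
    simp only [Set.mem_union, Set.mem_iUnion, Set.mem_ofPred_eq, not_or, not_exists,
      PLMixture.mixOfCoords_coords, PLMixture.rewardOfCoords_coords p _ hFc₁,
      PLMixture.rewardOfCoords_coords p _ hFc₂] at hx
    obtain ⟨⟨⟨hx₁, hx₂⟩, hx₃⟩, hx₄⟩ := hx
    have hcongr {L : Fin M → List T} (hF : ∀ j, ∀ t ∈ L j, t ∈ F) :
        (Matrix.of fun i j => plList (plWeight b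
          (PLMixture.rewardOfCoords F (p.coords F) i)) (L j)) =
        Matrix.of fun i j => plList (plWeight b (p.reward i)) (L j) := by
      ext i j
      refine plList_congr fun t ht => ?_
      simp only [plWeight, PLMixture.rewardOfCoords_coords p i (hF j t ht)]
    rw [hcongr hF₁] at hx₁
    rw [hcongr hF₂] at hx₂
    refine hp (PLMixture.identifiableAt_of_det_ne_zero hb hT hnodup hlen hL₁ hL₂ hx₁ hx₂ hx₃ ?_)
    intro i j hij
    by_contra hne
    exact hx₄ i j hne (sub_eq_zero.2 hij)
  · simp only [measure_union_null_iff, measure_iUnion_null_iff]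
    exact ⟨⟨⟨hdet (List.nodup_append.1 hn₀).1 hinj₁ hL₁ hF₁,
      hdet (List.nodup_append.1 hn₀).2.1 hinj₂ hL₂ hF₂⟩, hmix⟩, hpair⟩
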